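/- Let $\epsilon,\delta\in[0,1]$. Consider the binary symmetric wiretap channel with feedback in which, at each time $i$, the source sends $X(i)\in\{0,1\}$, the destination may send $X_1(i)\in\{0,1\}$, and the wiretapper receives $Z(i)=X(i)+X_1(i)+N_2(i) \bmod 2$. The destination is half-duplex: when it transmits it receives nothing (an erasure $\phi$), and when it listens it receives $X(i)+N_1(i) \bmod 2$. The noise sequences $N_1$ and $N_2$ are each i.i.d. with $\Pr\{N_1(i)=1\}=\epsilon$ and $\Pr\{N_2(i)=1\}=\delta$, may be correlated with each other, and are independent of the message, the encoder's randomness and $X_1$. Consider the following scheme, with a parameter $t\in[0,1]$ known to everyone. The destination privately generates $X_1(i)$, i.i.d. and independent of everything else, with $\Pr\{X_1(i)=1\}=t$; it transmits the symbol $1$ when $X_1(i)=1$ and listens when $X_1(i)=0$. The source ignores the feedback and sends a message $W$, uniform on a set of $M$ messages, by a stochastic encoder that maps $W$ to a word $X^n\in\{0,1\}^n$; the destination decodes $W$ from its $n$ received symbols in $\{0,\phi,1\}$. The scheme with parameter $t$ achieves the secrecy rate $R$ if for every $\eta>0$ and all sufficiently large $n$ there is such a code with $$\Big|\tfrac1n\log_2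 M-R\Big|\le\eta,\qquad P_e\le\eta,\qquad \tfrac1n H(W\mid Z^n)\ge R-\eta,$$ where $P_e$ is the average probability of decoding error and entropies are in bits. Write $[x]^+=\max\{0,x\}$, $a*b=a+b-2ab$, $H(x)=-x\log_2x-(1-x)\log_2(1-x)$ and $\hat\delta=\delta*t=\delta+t-2\delta t$. Then the maximum $$R_s^f=\max_{\mu,t\in[0,1]}\Big[(1-t)\big[H(\epsilon*\mu)-H(\epsilon)\big]-\big[H(\hat\delta*\mu)-H(\hat\delta)\big]\Big]^+$$ is attained, and the scheme, with $t$ taken from a maximizing pair $(\mu,t)$, achieves the secrecy rate $R_s^f$. -/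

import Mathlib

noncomputable section

namespace HalfDuplexWiretap

/-- Binary words of length `n`; addition is componentwise modulo `2`. -/
abbrev Word (n : ℕ) : Type := Fin n → ZMod 2

/-- Probability of `b` under the Bernoulli law with `Pr{1} = p`. -/
def bern (p : ℝ) (b : ZMod 2) : ℝ := if b = 1 then p else 1 - p

/-- Probability of the word `a` when its letters are i.i.d. with `Pr{1} = p`. -/
def iidBern (p : ℝ) {n : ℕ} (a : Word n) : ℝ := ∏ i, bern p (a i)

/-- The noise of a binary symmetric wiretap channel with parameters `ε` (destination) and `δ`
(wiretapper). `law n a b` is the probability that the first `n` noise letters are `a` at the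
destination and `b` at the wiretapper. Each of the two noise sequences is individually i.i.d.;
their joint law is otherwise arbitrary, so they may be correlated. -/
structure BSCNoise (ε δ : ℝ) where
  law : (n : ℕ) → Word n → Word n → ℝ
  nonneg : ∀ n a b, 0 ≤ law n a b
  fst_marginal : ∀ (n : ℕ) (a : Word n), ∑ b, law n a b = iidBern ε a
  snd_marginal : ∀ (n : ℕ) (b : Word n), ∑ a, law n a b = iidBern δ b

/-- The half-duplex destination's observation. At the times when it transmits (`x₁ i = 1`) it
receives nothing, an erasure `none`; at all other times it receives `x i + n₁ i`. -/
def received {n : ℕ} (x x₁ n₁ : Word n) : Fin n → Option (ZMod 2) :=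
  fun i => if x₁ i = 1 then none else some (x i + n₁ i)

/-- The wiretapper's observation. -/
def overheard {n : ℕ} (x x₁ n₂ : Word n) : Word n := x + x₁ + n₂

/-- An `(M, n)` code for the scheme: a stochastic encoder at the source, which ignores the
feedback (`enc w x` is the probability that message `w` is sent as the word `x`), and a decoder
acting on the destination's observation (which also reveals the key `x₁`). -/
structure Code (M n : ℕ) where
  enc : Fin M → Word n → ℝ
  enc_nonneg : ∀ w x, 0 ≤ enc w x
  enc_sum : ∀ w, ∑ x, enc w x = 1
  dec : (Fin n → Option (ZMod 2)) → Fin M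

section Scheme

variable {ε δ : ℝ} {M n : ℕ}

/-- Joint law of message `w` (uniform), channel input `x`, destination key `x₁` (i.i.d. with
`Pr{1} = t`, independent of everything else) and the two noise words. -/
def jointProb (N : BSCNoise ε δ) (t : ℝ) (c : Code M n) (w : Fin M) (x x₁ n₁ n₂ : Word n) : ℝ :=
  (1 / (M : ℝ)) * c.enc w x * iidBern t x₁ * N.law n n₁ n₂

/-- Average error probability at the destination. -/
def errorProb (N : BSCNoise ε δ) (t : ℝ) (c : Code M n) : ℝ :=
  ∑ w, ∑ x, ∑ x₁, ∑ n₁, ∑ n₂,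
    if c.dec (received x x₁ n₁) ≠ w then jointProb N t c w x x₁ n₁ n₂ else 0

/-- Joint law of the message `W` and the wiretapper's observation `Z`. -/
def messageObsProb (N : BSCNoise ε δ) (t : ℝ) (c : Code M n) (w : Fin M) (z : Word n) : ℝ :=
  ∑ x, ∑ x₁, ∑ n₁, ∑ n₂,
    if overheard x x₁ n₂ = z then jointProb N t c w x x₁ n₁ n₂ else 0

end Scheme

/-- Conditional entropy `H(A | B)` in bits, for a joint probability mass function `p`
on finite alphabets. -/
def condEntropy {α β : Type*} [Fintype α] [Fintype β] (p : α → β → ℝ) : ℝ :=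
  -∑ a, ∑ b, p a b * Real.logb 2 (p a b / ∑ a', p a' b)

/-- The scheme with feedback probability `t` achieves the (perfect) secrecy rate `R`. -/
def SchemeAchieves {ε δ : ℝ} (N : BSCNoise ε δ) (t R : ℝ) : Prop :=
  ∀ η : ℝ, 0 < η → ∃ n₀ : ℕ, ∀ n : ℕ, n₀ ≤ n → ∃ (M : ℕ) (c : Code M n),
    |Real.logb 2 M / n - R| ≤ η ∧
    errorProb N t c ≤ η ∧
    R - η ≤ condEntropy (messageObsProb N t c) / n

/-- Binary entropy in bits. -/
def H (p : ℝ) : ℝ := Real.binEntropy p / Real.log 2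

/-- The parameter of the cascade of two binary symmetric channels, `a + b - 2ab`. -/
def star (a b : ℝ) : ℝ := a + b - 2 * a * b

/-- The expression maximised over `μ` and `t`. -/
def secrecyRate (ε δ μ t : ℝ) : ℝ :=
  max 0 ((1 - t) * (H (star ε μ) - H ε) - (H (star (star δ t) μ) - H (star δ t)))

end HalfDuplexWiretap

end

/-! For fixed `t` the scheme is an ordinary memoryless wiretap channel. The destination sees a
binary symmetric channel with parameter `ε` preceded by an erasure of probability `t`; the
wiretapper sees a binary symmetric channel with parameter `star δ t`. The two outputs share the key
and possibly correlated noise, but the error probability involves only the first marginal channel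
and the equivocation only the second (`errorProb_eq`, `messageObsProb_eq`). With Bernoulli(`μ`)
input the bracket in the rate is `I(X;Y) - I(X;Z)`.

That rate is reached by random binning: `M` bins of `L` i.i.d. codewords, the message choosing the
bin and local randomness the codeword in it. Threshold decoding succeeds if `M * L` is slightly
below `exp (n I(X;Y))`. Soft covering (`sum_iid_mul_log_le`) makes each bin imitate the i.i.d.
output law at the wiretapper, up to small relative entropy per letter, once `L` is at least `exp (n
I(X;Z))`; no degradedness is needed. `exists_codebook` obtains both properties from one expectation,
`exists_memoryless_codebook` makes the bounds asymptotic using only the variance of the information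
density, and `logb_sub_le_condEntropy` turns relative entropy into equivocation.

A maximizing pair exists by compactness and continuity. If the maximum is zero, a single message
suffices. -/

noncomputable section

namespace HalfDuplexWiretap

open Finset

/-! ### Moments of functions of independent letters. -/

section Product

variable {ι α : Type*} [Fintype ι] [DecidableEq ι] [Fintype α]

/-- The weight of a family whose members are drawn independently with weights `p`. -/
def iid (p : α → ℝ) (c : ι → α) : ℝ := ∏ i, p (c i)

omit [DecidableEq ι] [Fintype α] in
lemma iid_nonneg {p : α → ℝ} (hp : ∀ a, 0 ≤ p a) (c : ι → α) : 0 ≤ iid p c :=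
  prod_nonneg fun _ _ => hp _

lemma sum_prod_apply (f : ι → α → ℝ) :
    ∑ c : ι → α, ∏ i, f i (c i) = ∏ i, ∑ a, f i a := by
  classical
  rw [Finset.prod_univ_sum, Fintype.piFinset_univ]

lemma sum_iid {p : α → ℝ} (hp : ∑ a, p a = 1) : ∑ c : ι → α, iid p c = 1 := by
  simp only [iid]
  rw [sum_prod_apply (fun _ => p)]
  simp [hp]

/-- Pairwise independence of the coordinates, the only form of independence that the variance and
random-coding computations need. -/
lemma sum_iid_mul_apply_mul_apply {p : α → ℝ} (hp : ∑ a, p a = 1) {i j : ι} (hij : i ≠ j)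
    (f g : α → ℝ) :
    ∑ c : ι → α, iid p c * (f (c i) * g (c j)) = (∑ a, p a * f a) * ∑ a, p a * g a := by
  have key := sum_prod_apply (ι := ι)
    (fun k a => p a * ((if k = i then f a else 1) * (if k = j then g a else 1)))
  have hl : ∀ c : ι → α, ∏ k, p (c k) * ((if k = i then f (c k) else 1) *
      (if k = j then g (c k) else 1)) = iid p c * (f (c i) * g (c j)) := by
    intro c
    rw [prod_mul_distrib, prod_mul_distrib, prod_ite_eq' univ i, prod_ite_eq' univ j]
    simp [iid]
  simp only [hl] at key
  rw [key, ← mul_prod_erase univ _ (mem_univ i),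
    ← mul_prod_erase (univ.erase i) _ (mem_erase.2 ⟨hij.symm, mem_univ j⟩), prod_eq_one]
  · simp [hij, hij.symm]
  · intro k hk
    simp only [mem_erase] at hk
    simp [hk.1, hk.2.1, hp]

lemma sum_iid_mul_apply {p : α → ℝ} (hp : ∑ a, p a = 1) (i : ι) (f : α → ℝ) :
    ∑ c : ι → α, iid p c * f (c i) = ∑ a, p a * f a := by
  have key := sum_prod_apply (ι := ι) (fun k a => p a * (if k = i then f a else 1))
  have hl : ∀ c : ι → α, ∏ k, p (c k) * (if k = i then f (c k) else 1) = iid p c * f (c i) := by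
    intro c
    rw [prod_mul_distrib, prod_ite_eq' univ i]
    simp [iid]
  simp only [hl] at key
  rw [key, ← mul_prod_erase univ _ (mem_univ i), prod_eq_one]
  · simp
  · intro k hk
    simp only [mem_erase] at hk
    simp [hk.1, hp]

/-- The variance of a sum of independent centred terms. -/
lemma sum_iid_mul_sq {p : α → ℝ} (hp : ∑ a, p a = 1) {f : α → ℝ} (hf : ∑ a, p a * f a = 0) :
    ∑ c : ι → α, iid p c * (∑ i, f (c i)) ^ 2 = Fintype.card ι * ∑ a, p a * f a ^ 2 := by
  have h1 : ∀ c : ι → α, iid p c * (∑ i, f (c i)) ^ 2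
      = ∑ i, ∑ j, iid p c * (f (c i) * f (c j)) := by
    intro c
    rw [sq, sum_mul_sum, mul_sum]
    exact sum_congr rfl fun i _ => by rw [mul_sum]
  simp only [h1]
  rw [sum_comm]
  have h2 : ∀ i : ι, ∑ c : ι → α, ∑ j, iid p c * (f (c i) * f (c j)) = ∑ a, p a * f a ^ 2 := by
    intro i
    rw [sum_comm, sum_eq_single i]
    · rw [sum_iid_mul_apply hp i (fun a => f a * f a)]
      exact sum_congr rfl fun a _ => by ring
    · intro j _ hj
      rw [sum_iid_mul_apply_mul_apply hp hj.symm, hf, zero_mul]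
    · simp
  simp [h2]

end Product

/-- A probability mass function on a finite alphabet. -/
structure IsPMF {α : Type*} [Fintype α] (p : α → ℝ) : Prop where
  nonneg : ∀ a, 0 ≤ p a
  sum_eq_one : ∑ a, p a = 1

/-- The output law of a channel `W` with input law `p`. -/
def outputLaw {α β : Type*} [Fintype α] (p : α → ℝ) (W : α → β → ℝ) (b : β) : ℝ :=
  ∑ a, p a * W a b

/-! ### One-shot random binning: soft covering, threshold decoding, equivocation. -/

section OneShot

variable {α β γ : Type*} [Fintype α] [Fintype β] [Fintype γ]

lemma outputLaw_isPMF {p : α → ℝ} {W : α → β → ℝ} (hp : IsPMF p) (hW : ∀ a, IsPMF (W a)) :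
    IsPMF (outputLaw p W) := by
  refine ⟨fun b => sum_nonneg fun a _ => mul_nonneg (hp.nonneg a) ((hW a).nonneg b), ?_⟩
  simp only [outputLaw]
  rw [sum_comm]
  simp [← mul_sum, (hW _).sum_eq_one, hp.sum_eq_one]

lemma mul_le_outputLaw {p : α → ℝ} {W : α → β → ℝ} (hp : IsPMF p) (hW : ∀ a, IsPMF (W a))
    (a : α) (b : β) : p a * W a b ≤ outputLaw p W b :=
  single_le_sum (f := fun a => p a * W a b)
    (fun a _ => mul_nonneg (hp.nonneg a) ((hW a).nonneg b)) (mem_univ a)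

/-- Soft covering: the expected log-likelihood ratio of the average of a random bin. -/
lemma sum_iid_mul_log_le {κ ℓ : Type*} [Fintype κ] [DecidableEq κ] [Fintype ℓ] [DecidableEq ℓ]
    {p : α → ℝ} (hp : IsPMF p) {v : α → ℝ} (hv : ∀ a, 0 ≤ v a) {e : ℓ → κ}
    (he : Function.Injective e) (l : ℓ) {q : ℝ} (hq : q = ∑ a, p a * v a) :
    ∑ c : κ → α, iid p c *
        (v (c (e l)) * Real.log ((1 / (Fintype.card ℓ : ℝ) * ∑ j, v (c (e j))) / q))
      ≤ ∑ a, p a * (v a * Real.log (1 + v a / (Fintype.card ℓ * q))) := by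
  set L : ℝ := (Fintype.card ℓ : ℝ) with hL
  have hLpos : 0 < L := by
    rw [hL]; exact_mod_cast Fintype.card_pos_iff.2 ⟨l⟩
  have hpv : ∀ a, 0 ≤ p a * v a := fun a => mul_nonneg (hp.nonneg a) (hv a)
  have hq0 : 0 ≤ q := hq ▸ sum_nonneg fun a _ => hpv a
  rcases hq0.eq_or_lt with h0 | hqpos
  -- With `q = 0` the quotients are zero by convention, and both logarithms vanish.
  · simp [← h0]
  set s : α → ℝ := fun a => 1 + v a / (L * q) with hs
  have hs1 : ∀ a, 0 < s a := fun a => by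
    have : 0 ≤ v a / (L * q) := div_nonneg (hv a) (by positivity)
    simp only [hs]; linarith
  -- Jensen's inequality through a tangent: `log u ≤ log s + u / s - 1`, with `u` the likelihood
  -- ratio of the bin. The point of tangency `s` slightly exceeds the conditional mean of `u` given
  -- the codeword `c (e l)`.
  have pointwise : ∀ c : κ → α, iid p c *
      (v (c (e l)) * Real.log ((1 / L * ∑ j, v (c (e j))) / q)) ≤
      iid p c * (v (c (e l)) * Real.log (s (c (e l)))) - iid p c * v (c (e l))
        + ∑ j, (1 / (L * q)) * (iid p c * (v (c (e l)) / s (c (e l)) * v (c (e j)))) := by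
    intro c
    have hid : iid p c * (v (c (e l)) * Real.log (s (c (e l)))) - iid p c * v (c (e l))
        + ∑ j, (1 / (L * q)) * (iid p c * (v (c (e l)) / s (c (e l)) * v (c (e j))))
        = iid p c * (v (c (e l)) * (Real.log (s (c (e l))) +
          ((1 / L * ∑ j, v (c (e j))) / q) / s (c (e l)) - 1)) := by
      rw [← mul_sum, ← mul_sum, ← mul_sum]
      have := (hs1 (c (e l))).ne'
      field_simp
      ring
    rw [hid]
    refine mul_le_mul_of_nonneg_left ?_ (iid_nonneg hp.nonneg c)
    rcases (hv (c (e l))).eq_or_lt with h | h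
    · simp [← h]
    refine mul_le_mul_of_nonneg_left ?_ h.le
    have hsum : 0 < ∑ j, v (c (e j)) :=
      h.trans_le (single_le_sum (f := fun j => v (c (e j))) (fun _ _ => hv _) (mem_univ l))
    have hu : 0 < (1 / L * ∑ j, v (c (e j))) / q := by positivity
    have := Real.log_le_sub_one_of_pos (div_pos hu (hs1 (c (e l))))
    rw [Real.log_div hu.ne' (hs1 _).ne'] at this
    linarith
  refine (sum_le_sum fun c _ => pointwise c).trans ?_
  rw [sum_add_distrib, sum_sub_distrib, sum_comm,
    sum_iid_mul_apply hp.sum_eq_one (e l) (fun a => v a * Real.log (s a)),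
    sum_iid_mul_apply hp.sum_eq_one (e l) v]
  -- Only `j = l` correlates with the codeword `l`; injectivity of `e` makes every other `j`
  -- independent of it.
  have hterm : ∀ j, ∑ c : κ → α, 1 / (L * q) * (iid p c * (v (c (e l)) / s (c (e l)) * v (c (e j))))
      = 1 / (L * q) * if j = l then ∑ a, p a * (v a / s a * v a)
          else (∑ a, p a * (v a / s a)) * q := by
    intro j
    rw [← mul_sum]
    congr 1
    split_ifs with hj
    · subst hj
      exact sum_iid_mul_apply hp.sum_eq_one (e j) (fun a => v a / s a * v a)
    · rw [sum_iid_mul_apply_mul_apply hp.sum_eq_one (fun h => hj (he h.symm))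
        (fun a => v a / s a) v, ← hq]
  simp only [hterm]
  rw [← mul_sum]
  have hcount : ∑ j : ℓ, (if j = l then ∑ a, p a * (v a / s a * v a)
      else (∑ a, p a * (v a / s a)) * q) ≤ (∑ a, p a * (v a / s a * v a)) +
        L * ((∑ a, p a * (v a / s a)) * q) := by
    have hB : 0 ≤ (∑ a, p a * (v a / s a)) * q :=
      mul_nonneg (sum_nonneg fun a _ =>
        mul_nonneg (hp.nonneg a) (div_nonneg (hv a) (hs1 a).le)) hq0
    have : ∀ j : ℓ, (if j = l then ∑ a, p a * (v a / s a * v a)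
      else (∑ a, p a * (v a / s a)) * q) ≤ (if j = l then ∑ a, p a * (v a / s a * v a) else 0) +
        (∑ a, p a * (v a / s a)) * q := by
      intro j
      split_ifs <;> linarith
    refine (sum_le_sum fun j _ => this j).trans ?_
    rw [sum_add_distrib]
    simp [hL]
  -- Counting `L` independent terms instead of `L - 1` is what matches the summand `1` in `s`: the
  -- linear correction then cancels exactly against the mean of `v`.
  have hbal : 1 / (L * q) * ((∑ a, p a * (v a / s a * v a)) +
        L * ((∑ a, p a * (v a / s a)) * q)) = ∑ a, p a * v a := by
    rw [sum_mul, mul_sum, ← sum_add_distrib, mul_sum]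
    refine sum_congr rfl fun a _ => ?_
    have h1 : s a * (L * q) = L * q + v a := by
      simp only [hs]; field_simp
    have h2 := (hs1 a).ne'
    have h3 : v a = s a * (L * q) - L * q := by linarith
    field_simp
    linear_combination (-(p a * v a)) * h1
  have h4 : (0 : ℝ) ≤ 1 / (L * q) := by positivity
  have := mul_le_mul_of_nonneg_left hcount h4
  rw [hbal] at this
  linarith

/-- The expected number of wrong codewords that pass the likelihood threshold `T`. -/
lemma sum_outputLaw_mul_le {p : α → ℝ} {W : α → β → ℝ} (hp : IsPMF p) (hW : ∀ a, IsPMF (W a))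
    {T : ℝ} (hT : 0 < T) :
    ∑ b, outputLaw p W b * ∑ a, p a * (if T * outputLaw p W b < W a b then 1 else 0) ≤ 1 / T := by
  have h : ∀ b, outputLaw p W b * ∑ a, p a * (if T * outputLaw p W b < W a b then 1 else 0)
      ≤ 1 / T * ∑ a, p a * W a b := by
    intro b
    rw [mul_sum, mul_sum]
    refine sum_le_sum fun a _ => ?_
    have h1 := (outputLaw_isPMF hp hW).nonneg b
    have h2 := hp.nonneg a
    have h3 := (hW a).nonneg b
    split_ifs with hlt
    · have : outputLaw p W b ≤ 1 / T * W a b := by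
        -- Change of measure: where the threshold is passed, the output law is at most `W / T`.
        rw [one_div, ← div_eq_inv_mul, le_div_iff₀ hT]; linarith
      nlinarith
    · simp only [mul_zero]; positivity
  refine (sum_le_sum fun b _ => h b).trans ?_
  rw [← mul_sum]
  have := (outputLaw_isPMF hp hW).sum_eq_one
  simp only [outputLaw] at this
  rw [this, mul_one]

omit [Fintype α] [Fintype β] in
/-- Some decoder finds the bin of a codeword unless the codeword fails the likelihood threshold or
another codeword passes it. -/
lemma exists_decoder {μ ℓ : Type*} [Fintype μ] [DecidableEq μ] [Fintype ℓ] [DecidableEq ℓ]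
    [Nonempty μ] (good : α → β → Prop) [∀ a b, Decidable (good a b)] (c : μ × ℓ → α) :
    ∃ dec : β → μ, ∀ (k : μ × ℓ) (b : β), (if dec b ≠ k.1 then (1 : ℝ) else 0) ≤
      (if good (c k) b then 0 else 1) +
        ∑ j ∈ univ.erase k, (if good (c j) b then (1 : ℝ) else 0) := by
  classical
  -- The decoder returns the bin of any codeword passing the test. If the sent codeword passes but
  -- another one is chosen, that other one is counted in the sum.
  refine ⟨fun b => if h : ∃ k, good (c k) b then h.choose.1 else Classical.arbitrary μ,
    fun k b => ?_⟩
  have hnn : (0 : ℝ) ≤ ∑ j ∈ univ.erase k, (if good (c j) b then (1 : ℝ) else 0) :=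
    sum_nonneg fun _ _ => by split_ifs <;> norm_num
  by_cases hk : good (c k) b
  · have hex : ∃ k, good (c k) b := ⟨k, hk⟩
    simp only [hex, dif_pos, if_pos hk]
    by_cases heq : hex.choose = k
    · rw [if_neg (by simpa using congrArg Prod.fst heq)]; linarith
    · have : (1 : ℝ) ≤ ∑ j ∈ univ.erase k, (if good (c j) b then (1 : ℝ) else 0) := by
        refine le_trans ?_ (single_le_sum
          (f := fun j => if good (c j) b then (1 : ℝ) else 0)
          (fun _ _ => by split_ifs <;> norm_num) (mem_erase.2 ⟨heq, mem_univ _⟩))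
        simp [hex.choose_spec]
      split_ifs <;> linarith
  · rw [if_neg hk]
    split_ifs <;> linarith

/-- The law of the wiretapper's observation when a codeword of bin `w` is sent. -/
def binLaw {μ ℓ : Type*} [Fintype ℓ] (V : α → γ → ℝ) (c : μ × ℓ → α) (w : μ) (z : γ) : ℝ :=
  1 / (Fintype.card ℓ : ℝ) * ∑ l, V (c (w, l)) z

/-- The relative entropy `D(u ‖ q)` in nats. -/
def relEntropy (u q : γ → ℝ) : ℝ := ∑ z, u z * Real.log (u z / q z)

/-- Absolute continuity has to be assumed: by the conventions for division and logarithm at zero, a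
letter with `q z = 0` contributes `0` instead of `∞`. -/
lemma relEntropy_nonneg {u q : γ → ℝ} (hu : IsPMF u) (hq : IsPMF q)
    (h : ∀ z, q z = 0 → u z = 0) : 0 ≤ relEntropy u q := by
  have key : ∀ z, u z - q z ≤ u z * Real.log (u z / q z) := by
    intro z
    rcases (hu.nonneg z).eq_or_lt with h0 | h0
    · simp [← h0, hq.nonneg z]
    have hqz : 0 < q z := (hq.nonneg z).lt_of_ne' fun h' => h0.ne' (h z h')
    have := Real.one_sub_inv_le_log_of_pos (div_pos h0 hqz)
    have h2 := mul_le_mul_of_nonneg_left this h0.le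
    refine le_trans (le_of_eq ?_) h2
    field_simp
  have := sum_le_sum fun z (_ : z ∈ univ) => key z
  rw [sum_sub_distrib, hu.sum_eq_one, hq.sum_eq_one, sub_self] at this
  exact this

omit [Fintype α] in
lemma binLaw_isPMF {μ ℓ : Type*} [Fintype ℓ] [Nonempty ℓ] {V : α → γ → ℝ}
    (hV : ∀ a, IsPMF (V a)) (c : μ × ℓ → α) (w : μ) : IsPMF (binLaw V c w) := by
  have : (Fintype.card ℓ : ℝ) ≠ 0 := by exact_mod_cast Fintype.card_ne_zero
  refine ⟨fun z => mul_nonneg (by positivity) (sum_nonneg fun l _ => (hV _).nonneg z), ?_⟩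
  simp only [binLaw]
  rw [← mul_sum, sum_comm]
  simp [(hV _).sum_eq_one, this]

/-- Supplies the absolute continuity required by the relative entropy lemmas; this is why the
selected codebook must have nonzero weight. -/
lemma binLaw_eq_zero {μ ℓ : Type*} [Fintype μ] [Fintype ℓ] {p : α → ℝ} {V : α → γ → ℝ}
    (hp : IsPMF p) (hV : ∀ a, IsPMF (V a)) {c : μ × ℓ → α} (hc : iid p c ≠ 0) (w : μ) {z : γ}
    (hz : outputLaw p V z = 0) : binLaw V c w z = 0 := by
  simp only [binLaw]
  rw [sum_eq_zero, mul_zero]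
  intro l _
  have h1 : p (c (w, l)) ≠ 0 := fun h => hc (prod_eq_zero (mem_univ (w, l)) h)
  have h2 := mul_le_outputLaw hp hV (c (w, l)) z
  rw [hz] at h2
  have h3 := mul_nonneg (hp.nonneg (c (w, l))) ((hV (c (w, l))).nonneg z)
  exact (mul_eq_zero.1 (le_antisymm h2 h3)).resolve_left h1

lemma sum_iid_mul_relEntropy_le {μ ℓ : Type*} [Fintype μ] [DecidableEq μ] [Fintype ℓ]
    [DecidableEq ℓ] [Nonempty ℓ] {p : α → ℝ} {V : α → γ → ℝ} (hp : IsPMF p)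
    (hV : ∀ a, IsPMF (V a)) (w : μ) :
    ∑ c : μ × ℓ → α, iid p c * relEntropy (binLaw V c w) (outputLaw p V) ≤
      ∑ a, ∑ z, p a * V a z * Real.log (1 + V a z / (Fintype.card ℓ * outputLaw p V z)) := by
  have hL : (0 : ℝ) < Fintype.card ℓ := by exact_mod_cast Fintype.card_pos
  have h1 : ∀ c : μ × ℓ → α, iid p c * relEntropy (binLaw V c w) (outputLaw p V) =
      ∑ z, ∑ l, 1 / (Fintype.card ℓ : ℝ) * (iid p c * (V (c (w, l)) z * Real.log
        ((1 / (Fintype.card ℓ : ℝ) * ∑ j, V (c (w, j)) z) / outputLaw p V z))) := by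
    intro c
    simp only [relEntropy, binLaw]
    rw [mul_sum]
    refine sum_congr rfl fun z _ => ?_
    rw [← mul_sum, ← mul_sum, ← sum_mul]
    ring
  simp only [h1]
  rw [sum_comm, sum_comm (s := univ (α := α))]
  refine sum_le_sum fun z _ => ?_
  rw [sum_comm]
  have h2 : ∀ l : ℓ, ∑ c : μ × ℓ → α, 1 / (Fintype.card ℓ : ℝ) * (iid p c * (V (c (w, l)) z *
      Real.log ((1 / (Fintype.card ℓ : ℝ) * ∑ j, V (c (w, j)) z) / outputLaw p V z))) ≤
      1 / (Fintype.card ℓ : ℝ) *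
        ∑ a, p a * V a z * Real.log (1 + V a z / (Fintype.card ℓ * outputLaw p V z)) := by
    intro l
    rw [← mul_sum]
    refine mul_le_mul_of_nonneg_left ?_ (by positivity)
    refine (sum_iid_mul_log_le hp (fun a => (hV a).nonneg z) (e := fun l => (w, l))
      (fun _ _ h => (Prod.mk.inj h).2) l (q := outputLaw p V z) rfl).trans (le_of_eq ?_)
    exact sum_congr rfl fun a _ => by ring
  refine (sum_le_sum fun l _ => h2 l).trans (le_of_eq ?_)
  rw [sum_const, card_univ, nsmul_eq_mul]
  field_simp

/-- One-shot wiretap coding by random binning: there are a codebook and a decoder whose error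
probability and leakage are jointly bounded. -/
lemma exists_codebook {μ ℓ : Type*} [Fintype μ] [DecidableEq μ] [Nonempty μ] [Fintype ℓ]
    [DecidableEq ℓ] [Nonempty ℓ] {p : α → ℝ} {W : α → β → ℝ} {V : α → γ → ℝ} (hp : IsPMF p)
    (hW : ∀ a, IsPMF (W a)) (hV : ∀ a, IsPMF (V a)) {T s : ℝ} (hT : 0 < T) (hs : 0 ≤ s) :
    ∃ (c : μ × ℓ → α) (dec : β → μ), iid p c ≠ 0 ∧
      1 / (Fintype.card (μ × ℓ) : ℝ) * (∑ k, ∑ b, W (c k) b * if dec b ≠ k.1 then 1 else 0) +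
        s * (1 / (Fintype.card μ : ℝ) * ∑ w, relEntropy (binLaw V c w) (outputLaw p V)) ≤
      (∑ a, ∑ b, p a * W a b * if W a b ≤ T * outputLaw p W b then 1 else 0) +
        Fintype.card (μ × ℓ) / T +
        s * ∑ a, ∑ z, p a * V a z * Real.log (1 + V a z / (Fintype.card ℓ * outputLaw p V z)) := by
  classical
  set q := outputLaw p W with hq
  set K : ℝ := (Fintype.card (μ × ℓ) : ℝ) with hK
  have hKpos : 0 < K := by rw [hK]; exact_mod_cast Fintype.card_pos
  have hMpos : (0 : ℝ) < Fintype.card μ := by exact_mod_cast Fintype.card_pos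
  choose dec hdec using fun c : μ × ℓ → α =>
    exists_decoder (μ := μ) (ℓ := ℓ) (fun a b => T * q b < W a b) c
  -- Error and weighted leakage are added so that one averaging argument controls both for the same
  -- codebook.
  set F : (μ × ℓ → α) → ℝ := fun c =>
    1 / K * (∑ k, ∑ b, W (c k) b * if dec c b ≠ k.1 then 1 else 0) +
        s * (1 / (Fintype.card μ : ℝ) * ∑ w, relEntropy (binLaw V c w) (outputLaw p V)) with hF
  set B : ℝ := (∑ a, ∑ b, p a * W a b * if W a b ≤ T * q b then 1 else 0) + K / T +
        s * ∑ a, ∑ z, p a * V a z * Real.log (1 + V a z / (Fintype.card ℓ * outputLaw p V z))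
    with hB
  have herr : ∀ k : μ × ℓ, ∑ c, iid p c * ∑ b, W (c k) b * (if dec c b ≠ k.1 then 1 else 0) ≤
      (∑ a, ∑ b, p a * W a b * if W a b ≤ T * q b then 1 else 0) + K / T := by
    intro k
    have h1 : ∀ c : μ × ℓ → α, iid p c * ∑ b, W (c k) b * (if dec c b ≠ k.1 then 1 else 0) ≤
        iid p c * (∑ b, W (c k) b * if W (c k) b ≤ T * q b then 1 else 0) +
        ∑ j ∈ univ.erase k, ∑ b, iid p c * (W (c k) b * if T * q b < W (c j) b then 1 else 0) := by
      intro c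
      have : iid p c * (∑ b, W (c k) b * if W (c k) b ≤ T * q b then 1 else 0) +
        ∑ j ∈ univ.erase k, ∑ b, iid p c * (W (c k) b * if T * q b < W (c j) b then 1 else 0) =
          iid p c * ∑ b, W (c k) b * ((if T * q b < W (c k) b then 0 else 1) +
            ∑ j ∈ univ.erase k, if T * q b < W (c j) b then 1 else 0) := by
        rw [sum_comm]
        simp only [mul_add, sum_add_distrib, mul_sum]
        congr 1
        refine sum_congr rfl fun b _ => ?_
        by_cases h : T * q b < W (c k) b
        · simp [h, not_le.2 h]
        · simp [h, not_lt.1 h]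
      rw [this]
      refine mul_le_mul_of_nonneg_left (sum_le_sum fun b _ => ?_) (iid_nonneg hp.nonneg c)
      exact mul_le_mul_of_nonneg_left (hdec c k b) ((hW _).nonneg b)
    refine (sum_le_sum fun c _ => h1 c).trans ?_
    rw [sum_add_distrib, sum_iid_mul_apply hp.sum_eq_one k
      (fun a => ∑ b, W a b * if W a b ≤ T * q b then 1 else 0), sum_comm]
    have h2 : ∀ j ∈ univ.erase k, ∑ c : μ × ℓ → α, ∑ b, iid p c *
        (W (c k) b * if T * q b < W (c j) b then 1 else 0) ≤ 1 / T := by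
      intro j hj
      rw [sum_comm]
      -- A wrong codeword is independent of the sent one, so averaging over the latter replaces `W
      -- (c k)` by the output law.
      refine le_trans (le_of_eq (sum_congr rfl fun b _ => ?_)) (sum_outputLaw_mul_le hp hW hT)
      exact sum_iid_mul_apply_mul_apply hp.sum_eq_one (ne_of_mem_erase hj).symm
        (fun a => W a b) (fun a => if T * q b < W a b then 1 else 0)
    have h3 := sum_le_card_nsmul _ _ _ h2
    have h4 : ((univ.erase k).card : ℝ) ≤ K := by
      rw [hK]; exact_mod_cast card_le_univ _
    rw [nsmul_eq_mul] at h3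
    have h5 : ((univ.erase k).card : ℝ) * (1 / T) ≤ K / T := by
      rw [mul_one_div]; gcongr
    simp only [mul_sum] at h3 ⊢
    simp only [mul_assoc]
    linarith
  have hmean : ∑ c, iid p c * F c ≤ B := by
    have h1 : ∑ c, iid p c * F c =
        1 / K * (∑ k : μ × ℓ, ∑ c : μ × ℓ → α, iid p c * ∑ b, W (c k) b * (if dec c b ≠ k.1 then 1 else 0)) +
        s * (1 / (Fintype.card μ : ℝ) *
          ∑ w : μ, ∑ c : μ × ℓ → α, iid p c * relEntropy (binLaw V c w) (outputLaw p V)) := by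
      rw [sum_comm (s := univ (α := μ × ℓ)), sum_comm (s := univ (α := μ))]
      simp only [← mul_sum (s := univ (α := μ × ℓ)), ← mul_sum (s := univ (α := μ))]
      rw [mul_sum, mul_sum, mul_sum, ← sum_add_distrib]
      refine sum_congr rfl fun c _ => ?_
      simp only [hF]
      ring
    rw [h1, hB]
    have h2 := sum_le_card_nsmul univ _ _ fun k _ => herr k
    have h3 := sum_le_card_nsmul univ _ _ fun w (_ : w ∈ univ (α := μ)) =>
      sum_iid_mul_relEntropy_le (ℓ := ℓ) hp hV w
    rw [nsmul_eq_mul, card_univ] at h2 h3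
    refine add_le_add ?_ (mul_le_mul_of_nonneg_left ?_ hs)
    · rw [one_div_mul_eq_div, div_le_iff₀ hKpos, mul_comm]; exact h2
    · rw [one_div_mul_eq_div, div_le_iff₀ hMpos, mul_comm]; exact h3
  -- Otherwise every codebook of nonzero weight would exceed `B`, and so would the mean of `F`.
  by_contra! hcon
  have hlt : ∑ c : μ × ℓ → α, iid p c * B < ∑ c, iid p c * F c := by
    obtain ⟨c, -, hc⟩ := exists_ne_zero_of_sum_ne_zero
      (s := univ) (f := fun c : μ × ℓ → α => iid p c) (by rw [sum_iid hp.sum_eq_one]; simp)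
    refine sum_lt_sum (fun c _ => ?_) ⟨c, mem_univ c, ?_⟩
    · by_cases h : iid p c = 0
      · simp [h]
      · exact mul_le_mul_of_nonneg_left (hcon c (dec c) h).le (iid_nonneg hp.nonneg c)
    · exact mul_lt_mul_of_pos_left (hcon c (dec c) hc) ((iid_nonneg hp.nonneg c).lt_of_ne' hc)
  rw [← sum_mul, sum_iid hp.sum_eq_one, one_mul] at hlt
  linarith

/-- The equivocation of a uniform message is its entropy less at most the mean relative entropy to
an arbitrary output law. -/
lemma logb_sub_le_condEntropy {M : ℕ} (hM : 0 < M) {u : Fin M → γ → ℝ} {q : γ → ℝ}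
    (hu : ∀ w, IsPMF (u w)) (hq : IsPMF q) (h : ∀ w z, q z = 0 → u w z = 0) :
    Real.logb 2 M - 1 / (M : ℝ) * (∑ w, relEntropy (u w) q) / Real.log 2 ≤
      condEntropy fun w z => 1 / (M : ℝ) * u w z := by
  have hM0 : (0 : ℝ) < M := by exact_mod_cast hM
  have hlog : 0 < Real.log 2 := Real.log_pos (by norm_num)
  set r : γ → ℝ := fun z => ∑ w, 1 / (M : ℝ) * u w z with hr
  have hp0 : ∀ w z, 0 ≤ 1 / (M : ℝ) * u w z := fun w z =>
    mul_nonneg (by positivity) ((hu w).nonneg z)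
  have hr0 : ∀ z, 0 ≤ r z := fun z => sum_nonneg fun w _ => hp0 w z
  have hsum : ∑ w, ∑ z, 1 / (M : ℝ) * u w z = 1 := by
    simp only [← mul_sum, (hu _).sum_eq_one]
    simp [hM0.ne']
  -- The mixture `r` minimizes the mean relative entropy. Replacing it by `q` costs `log (q / r) ≤ q
  -- / r - 1`, whose mean is at most zero.
  have key : ∀ w z, 1 / (M : ℝ) * u w z * Real.log (1 / (M : ℝ) * u w z / r z) ≤
      1 / (M : ℝ) * (u w z * Real.log (u w z / q z)) + 1 / (M : ℝ) * u w z * (q z / r z)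
        - 1 / (M : ℝ) * u w z - 1 / (M : ℝ) * u w z * Real.log M := by
    intro w z
    rcases ((hu w).nonneg z).eq_or_lt with h0 | h0
    · simp [← h0]
    have hqz : 0 < q z := (hq.nonneg z).lt_of_ne' fun h' => h0.ne' (h w z h')
    have hrz : 0 < r z := lt_of_lt_of_le (by positivity)
      (single_le_sum (f := fun w => 1 / (M : ℝ) * u w z) (fun w _ => hp0 w z) (mem_univ w))
    have h1 := Real.log_le_sub_one_of_pos (div_pos hqz hrz)
    rw [Real.log_div hqz.ne' hrz.ne'] at h1
    have h2 : Real.log (1 / (M : ℝ) * u w z / r z) =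
        Real.log (u w z / q z) + (Real.log (q z) - Real.log (r z)) - Real.log M := by
      rw [Real.log_div (by positivity) hrz.ne', Real.log_mul (by positivity) h0.ne',
        Real.log_div h0.ne' hqz.ne', one_div, Real.log_inv]
      ring
    rw [h2]
    have h3 := mul_le_mul_of_nonneg_left h1 (hp0 w z)
    linarith
  have htot := sum_le_sum fun w (_ : w ∈ univ) => sum_le_sum fun z (_ : z ∈ univ) => key w z
  simp only [sum_add_distrib, sum_sub_distrib, ← sum_mul] at htot
  -- Only an inequality, since `q` may charge letters where `r` vanishes.
  have hq1 : ∑ w, ∑ z, 1 / (M : ℝ) * u w z * (q z / r z) ≤ 1 := by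
    rw [sum_comm]
    refine (sum_le_sum (g := q) fun z _ => ?_).trans hq.sum_eq_one.le
    rw [← sum_mul]
    change r z * (q z / r z) ≤ q z
    rcases (hr0 z).eq_or_lt with h0 | h0
    · simp [← h0, hq.nonneg z]
    · rw [mul_div_cancel₀ _ h0.ne']
  have hS : 1 / (M : ℝ) * ∑ w, relEntropy (u w) q =
      ∑ w, ∑ z, 1 / (M : ℝ) * (u w z * Real.log (u w z / q z)) := by
    simp only [relEntropy, mul_sum]
  have hE : (condEntropy fun w z => 1 / (M : ℝ) * u w z) =
      -(∑ w, ∑ z, 1 / (M : ℝ) * u w z * Real.log (1 / (M : ℝ) * u w z / r z)) / Real.log 2 := by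
    simp only [condEntropy, Real.logb, neg_div, sum_div]
    congr 1
    exact sum_congr rfl fun w _ => sum_congr rfl fun z _ => (mul_div_assoc _ _ _).symm
  rw [hE, hS, Real.logb, ← sub_div]
  refine div_le_div_of_nonneg_right ?_ hlog.le
  rw [hsum] at htot
  linarith

end OneShot

/-! ### Memoryless channels: asymptotics from the variance of the information density. -/

section Memoryless

variable {α β γ : Type*} [Fintype α] [Fintype β] [Fintype γ] {n : ℕ}

/-- The `n`-fold use of a memoryless channel. -/
def memoryless (W : α → β → ℝ) (x : Fin n → α) (y : Fin n → β) : ℝ := ∏ i, W (x i) (y i)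

lemma iid_isPMF {ι : Type*} [Fintype ι] [DecidableEq ι] {p : α → ℝ} (hp : IsPMF p) :
    IsPMF (iid p : (ι → α) → ℝ) :=
  ⟨iid_nonneg hp.nonneg, sum_iid hp.sum_eq_one⟩

omit [Fintype α] in
lemma memoryless_isPMF {W : α → β → ℝ} (hW : ∀ a, IsPMF (W a)) (x : Fin n → α) :
    IsPMF (memoryless W x) := by
  refine ⟨fun y => prod_nonneg fun i _ => (hW _).nonneg _, ?_⟩
  simp only [memoryless]
  rw [sum_prod_apply (fun i b => W (x i) b)]
  simp [(hW _).sum_eq_one]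

omit [Fintype β] in
lemma outputLaw_memoryless (p : α → ℝ) (W : α → β → ℝ) (y : Fin n → β) :
    outputLaw (iid p) (memoryless W) y = iid (outputLaw p W) y := by
  simp only [outputLaw, iid, memoryless, ← prod_mul_distrib]
  exact sum_prod_apply (fun i a => p a * W a (y i))

/-- The mutual information, in nats, between input and output of the channel `W` with input
law `p`. -/
def mutualInfo (p : α → ℝ) (W : α → β → ℝ) : ℝ :=
  ∑ a, ∑ b, p a * W a b * Real.log (W a b / outputLaw p W b)

/-- The centred information density. -/
def infoDeviation (p : α → ℝ) (W : α → β → ℝ) (a : α) (b : β) : ℝ :=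
  Real.log (W a b / outputLaw p W b) - mutualInfo p W

/-- The variance of the information density. -/
def infoVariance (p : α → ℝ) (W : α → β → ℝ) : ℝ :=
  ∑ a, ∑ b, p a * W a b * infoDeviation p W a b ^ 2

lemma jointLaw_isPMF {p : α → ℝ} {W : α → β → ℝ} (hp : IsPMF p) (hW : ∀ a, IsPMF (W a)) :
    IsPMF fun ab : α × β => p ab.1 * W ab.1 ab.2 := by
  refine ⟨fun ab => mul_nonneg (hp.nonneg _) ((hW _).nonneg _), ?_⟩
  rw [Fintype.sum_prod_type]
  simp [← mul_sum, (hW _).sum_eq_one, hp.sum_eq_one]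

lemma infoVariance_nonneg {p : α → ℝ} {W : α → β → ℝ} (hp : IsPMF p) (hW : ∀ a, IsPMF (W a)) :
    0 ≤ infoVariance p W :=
  sum_nonneg fun a _ => sum_nonneg fun b _ =>
    mul_nonneg (mul_nonneg (hp.nonneg a) ((hW a).nonneg b)) (sq_nonneg _)

/-- It is the relative entropy of the joint law to the product of its marginals. -/
lemma mutualInfo_nonneg {p : α → ℝ} {W : α → β → ℝ} (hp : IsPMF p) (hW : ∀ a, IsPMF (W a)) :
    0 ≤ mutualInfo p W := by
  have hQ := outputLaw_isPMF hp hW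
  have hprod : IsPMF fun ab : α × β => p ab.1 * outputLaw p W ab.2 :=
    jointLaw_isPMF hp fun _ => hQ
  have h := relEntropy_nonneg (jointLaw_isPMF hp hW) hprod fun ab h0 => ?_
  · refine h.trans_eq ?_
    simp only [relEntropy, mutualInfo]
    rw [Fintype.sum_prod_type]
    refine sum_congr rfl fun a _ => sum_congr rfl fun b _ => ?_
    rcases eq_or_ne (p a) 0 with h | h
    · simp [h]
    · rw [mul_div_mul_left _ _ h]
  · rcases mul_eq_zero.1 h0 with h | h
    · simp [h]
    · have := mul_le_outputLaw hp hW ab.1 ab.2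
      rw [h] at this
      exact le_antisymm this (mul_nonneg (hp.nonneg _) ((hW _).nonneg _))

lemma sum_mul_infoDeviation_sq {p : α → ℝ} {W : α → β → ℝ} (hp : IsPMF p)
    (hW : ∀ a, IsPMF (W a)) :
    ∑ x : Fin n → α, ∑ y : Fin n → β, iid p x * memoryless W x y *
      (∑ i, infoDeviation p W (x i) (y i)) ^ 2 = n * infoVariance p W := by
  have hJ := jointLaw_isPMF hp hW
  have hmean : ∑ ab : α × β, p ab.1 * W ab.1 ab.2 * infoDeviation p W ab.1 ab.2 = 0 := by
    simp only [infoDeviation, mul_sub, sum_sub_distrib, ← sum_mul, hJ.sum_eq_one]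
    rw [Fintype.sum_prod_type]
    simp [mutualInfo]
  have h := sum_iid_mul_sq (ι := Fin n) hJ.sum_eq_one
    (f := fun ab => infoDeviation p W ab.1 ab.2) hmean
  rw [Fintype.card_fin, Fintype.sum_prod_type (f := fun ab : α × β => _)] at h
  rw [infoVariance, ← h, ← Fintype.sum_prod_type (f := fun xy : (Fin n → α) × (Fin n → β) =>
    iid p xy.1 * memoryless W xy.1 xy.2 * (∑ i, infoDeviation p W (xy.1 i) (xy.2 i)) ^ 2)]
  -- A pair of words is read as one i.i.d. word of letter pairs.
  refine Fintype.sum_equiv (Equiv.arrowProdEquivProdArrow (Fin n) (fun _ => α) fun _ => β).symm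
    _ _ fun xy => ?_
  simp [iid, memoryless, prod_mul_distrib, Equiv.arrowProdEquivProdArrow]

/-- The restriction to the support matters: with `Real.log 0 = 0` the exponential form can fail
where a transition has probability zero. -/
lemma memoryless_eq_exp_mul {p : α → ℝ} {W : α → β → ℝ} (hp : IsPMF p) (hW : ∀ a, IsPMF (W a))
    {x : Fin n → α} {y : Fin n → β} (h : iid p x * memoryless W x y ≠ 0) :
    0 < iid (outputLaw p W) y ∧ memoryless W x y =
      Real.exp (n * mutualInfo p W + ∑ i, infoDeviation p W (x i) (y i)) *
        iid (outputLaw p W) y := by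
  have h1 : ∀ i, 0 < p (x i) := fun i =>
    (hp.nonneg _).lt_of_ne' (prod_ne_zero_iff.1 (left_ne_zero_of_mul h) i (mem_univ i))
  have h2 : ∀ i, 0 < W (x i) (y i) := fun i =>
    ((hW _).nonneg _).lt_of_ne' (prod_ne_zero_iff.1 (right_ne_zero_of_mul h) i (mem_univ i))
  have h3 : ∀ i, 0 < outputLaw p W (y i) := fun i =>
    (mul_pos (h1 i) (h2 i)).trans_le (mul_le_outputLaw hp hW _ _)
  refine ⟨prod_pos fun i _ => h3 i, ?_⟩
  have h4 : n * mutualInfo p W + ∑ i, infoDeviation p W (x i) (y i) =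
      ∑ i, Real.log (W (x i) (y i) / outputLaw p W (y i)) := by
    simp [infoDeviation]
  rw [h4, Real.exp_sum, iid, memoryless, ← prod_mul_distrib]
  refine prod_congr rfl fun i _ => ?_
  rw [Real.exp_log (div_pos (h2 i) (h3 i)), div_mul_cancel₀ _ (h3 i).ne']

/-- Chebyshev's inequality for the information density. -/
lemma sum_threshold_le {p : α → ℝ} {W : α → β → ℝ} (hp : IsPMF p) (hW : ∀ a, IsPMF (W a))
    (hn : 0 < n) {δ : ℝ} (hδ : 0 < δ) :
    ∑ x : Fin n → α, ∑ y : Fin n → β, iid p x * memoryless W x y *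
      (if memoryless W x y ≤ Real.exp (n * (mutualInfo p W - δ)) *
        outputLaw (iid p) (memoryless W) y then 1 else 0) ≤ infoVariance p W / δ ^ 2 / n := by
  have hn0 : (0 : ℝ) < n := by exact_mod_cast hn
  have key : ∀ (x : Fin n → α) (y : Fin n → β), iid p x * memoryless W x y *
      (if memoryless W x y ≤ Real.exp (n * (mutualInfo p W - δ)) *
        outputLaw (iid p) (memoryless W) y then 1 else 0) ≤
      iid p x * memoryless W x y * (∑ i, infoDeviation p W (x i) (y i)) ^ 2 * (1 / (n * δ) ^ 2) := by
    intro x y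
    have h0 : 0 ≤ iid p x * memoryless W x y :=
      mul_nonneg ((iid_isPMF hp).nonneg x) ((memoryless_isPMF hW x).nonneg y)
    rcases eq_or_ne (iid p x * memoryless W x y) 0 with h | h
    · simp [h]
    obtain ⟨hQ, heq⟩ := memoryless_eq_exp_mul hp hW h
    rw [mul_assoc (iid p x * memoryless W x y)]
    refine mul_le_mul_of_nonneg_left ?_ h0
    split_ifs with hle
    · rw [outputLaw_memoryless, heq, mul_le_mul_iff_left₀ hQ, Real.exp_le_exp] at hle
      rw [mul_one_div, one_le_div (by positivity)]
      have : n * δ ≤ -∑ i, infoDeviation p W (x i) (y i) := by linarith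
      calc (n * δ) ^ 2 ≤ (-∑ i, infoDeviation p W (x i) (y i)) ^ 2 :=
            pow_le_pow_left₀ (by positivity) this 2
        _ = _ := neg_sq _
    · positivity
  refine (sum_le_sum fun x _ => sum_le_sum fun y _ => key x y).trans ?_
  simp only [← sum_mul]
  rw [sum_mul_infoDeviation_sq hp hW]
  refine le_of_eq ?_
  field_simp

/-- The leakage bound of soft covering is sublinear at the rate of the mutual information. -/
lemma sum_log_one_add_le {p : α → ℝ} {V : α → γ → ℝ} (hp : IsPMF p) (hV : ∀ a, IsPMF (V a))
    (hn : 0 < n) {κ L : ℝ} (hκ : 0 < κ) (hL : Real.exp (n * mutualInfo p V) ≤ L) :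
    ∑ x : Fin n → α, ∑ z : Fin n → γ, iid p x * memoryless V x z *
      Real.log (1 + memoryless V x z / (L * outputLaw (iid p) (memoryless V) z)) ≤
        Real.log 2 + n * κ + infoVariance p V / (4 * κ) := by
  have hn0 : (0 : ℝ) < n := by exact_mod_cast hn
  have hL0 : 0 < L := (Real.exp_pos _).trans_le hL
  have key : ∀ (x : Fin n → α) (z : Fin n → γ), iid p x * memoryless V x z *
      Real.log (1 + memoryless V x z / (L * outputLaw (iid p) (memoryless V) z)) ≤
      iid p x * memoryless V x z * (Real.log 2 + n * κ) +
        iid p x * memoryless V x z * (∑ i, infoDeviation p V (x i) (z i)) ^ 2 *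
          (1 / (4 * n * κ)) := by
    intro x z
    have h0 : 0 ≤ iid p x * memoryless V x z :=
      mul_nonneg ((iid_isPMF hp).nonneg x) ((memoryless_isPMF hV x).nonneg z)
    rcases eq_or_ne (iid p x * memoryless V x z) 0 with h | h
    · simp [h]
    obtain ⟨hQ, heq⟩ := memoryless_eq_exp_mul hp hV h
    rw [mul_assoc (iid p x * memoryless V x z), ← mul_add]
    refine mul_le_mul_of_nonneg_left ?_ h0
    set s := ∑ i, infoDeviation p V (x i) (z i) with hs
    have hratio : memoryless V x z / (L * outputLaw (iid p) (memoryless V) z) ≤ Real.exp s := by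
      rw [outputLaw_memoryless, heq, mul_div_mul_right _ _ hQ.ne', div_le_iff₀ hL0, Real.exp_add,
        mul_comm]
      exact mul_le_mul_of_nonneg_left hL (Real.exp_pos _).le
    have hpos : 0 ≤ memoryless V x z / (L * outputLaw (iid p) (memoryless V) z) := by
      rw [outputLaw_memoryless]
      exact div_nonneg ((memoryless_isPMF hV x).nonneg z) (by positivity)
    -- Completing the square trades the deviation `s` for its square. The mean of `s ^ 2` is `n`
    -- times the variance, so this term stays bounded in `n` and no tail estimate is needed.
    have hbd : s ≤ n * κ + s ^ 2 * (1 / (4 * n * κ)) := by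
      have : n * κ + s ^ 2 * (1 / (4 * n * κ)) - s = (s - 2 * n * κ) ^ 2 / (4 * n * κ) := by
        field_simp; ring
      have h2 : 0 ≤ (s - 2 * n * κ) ^ 2 / (4 * n * κ) := by positivity
      linarith
    set t := n * κ + s ^ 2 * (1 / (4 * n * κ)) with ht
    have ht0 : 0 ≤ t := by positivity
    have h1 : 1 + memoryless V x z / (L * outputLaw (iid p) (memoryless V) z) ≤
        2 * Real.exp t := by
      have := Real.exp_le_exp.2 hbd
      have := Real.one_le_exp ht0
      linarith
    have h2 := Real.log_le_log (by linarith) h1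
    rw [Real.log_mul (by norm_num) (Real.exp_pos _).ne', Real.log_exp] at h2
    linarith
  refine (sum_le_sum fun x _ => sum_le_sum fun z _ => key x z).trans ?_
  simp only [sum_add_distrib, ← sum_mul]
  rw [sum_mul_infoDeviation_sq hp hV]
  simp only [← mul_sum, (memoryless_isPMF hV _).sum_eq_one, mul_one]
  rw [(iid_isPMF hp).sum_eq_one]
  refine le_of_eq ?_
  field_simp

/-- Rounding up costs at most a factor 2 because the exponential is at least 1. -/
lemma natCeil_exp_bounds {x : ℝ} (hx : 0 ≤ x) :
    Real.exp x ≤ ⌈Real.exp x⌉₊ ∧ (⌈Real.exp x⌉₊ : ℝ) ≤ 2 * Real.exp x := by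
  refine ⟨Nat.le_ceil _, ?_⟩
  have := Nat.ceil_lt_add_one (Real.exp_pos x).le
  have := Real.one_le_exp hx
  linarith

/-- Wiretap codes for memoryless channels at the rate `I(X;Y) - I(X;Z)`. -/
theorem exists_memoryless_codebook {p : α → ℝ} {W : α → β → ℝ} {V : α → γ → ℝ} (hp : IsPMF p)
    (hW : ∀ a, IsPMF (W a)) (hV : ∀ a, IsPMF (V a)) (hpos : mutualInfo p V < mutualInfo p W)
    {η : ℝ} (hη : 0 < η) :
    ∃ n₀ : ℕ, ∀ n : ℕ, n₀ ≤ n → 0 < n ∧ ∃ (M L : ℕ) (c : Fin M × Fin L → (Fin n → α))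
      (dec : (Fin n → β) → Fin M), 0 < M ∧ 0 < L ∧ iid (iid p) c ≠ 0 ∧
      |Real.log M / n - (mutualInfo p W - mutualInfo p V)| ≤ η ∧
      1 / ((M : ℝ) * L) * (∑ k, ∑ y, memoryless W (c k) y * if dec y ≠ k.1 then 1 else 0) ≤ η ∧
      1 / (M : ℝ) * (∑ w, relEntropy (binLaw (memoryless V) c w)
        (outputLaw (iid p) (memoryless V))) ≤ n * η := by
  set IW := mutualInfo p W with hIW
  set IV := mutualInfo p V with hIV
  have hIV0 : 0 ≤ IV := mutualInfo_nonneg hp hV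
  -- Small enough that the message exponent `IW - IV - 2 * δ` stays nonnegative and the rate loss `2
  -- * δ` is at most `η / 2`.
  set δ := min η (IW - IV) / 4 with hδ
  have hδ0 : 0 < δ := by
    have : 0 < min η (IW - IV) := lt_min hη (by linarith)
    positivity
  have hδη : 4 * δ ≤ η := by have := min_le_left η (IW - IV); linarith
  have hδR : 4 * δ ≤ IW - IV := by have := min_le_right η (IW - IV); linarith
  have hlog2 : 0 < Real.log 2 := Real.log_pos (by norm_num)
  have hvW := infoVariance_nonneg hp hW
  have hvV := infoVariance_nonneg hp hV
  -- `C / n` collects every vanishing term of the final bound; `n₀` is chosen to make it at most `η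
  -- / 2`.
  set C := infoVariance p W / δ ^ 2 + 4 / δ + Real.log 2 + infoVariance p V / (4 * (η / 2)) with hC
  have hC2 : Real.log 2 ≤ C := by
    have h1 : 0 ≤ infoVariance p W / δ ^ 2 := by positivity
    have h2 : 0 ≤ 4 / δ := by positivity
    have h3 : 0 ≤ infoVariance p V / (4 * (η / 2)) := by positivity
    linarith
  refine ⟨⌈2 * C / η⌉₊ + 1, fun n hn => ?_⟩
  have hn1 : 0 < n := by omega
  have hn0 : (0 : ℝ) < n := by exact_mod_cast hn1
  have hCn : C / n ≤ η / 2 := by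
    have h1 : 2 * C / η ≤ n := (Nat.le_ceil _).trans (by exact_mod_cast (by omega))
    rw [div_le_iff₀ hη] at h1
    rw [div_le_iff₀ hn0]
    linarith
  refine ⟨hn1, ⌈Real.exp (n * (IW - IV - 2 * δ))⌉₊, ⌈Real.exp (n * IV)⌉₊, ?_⟩
  obtain ⟨hM1, hM2⟩ := natCeil_exp_bounds (x := n * (IW - IV - 2 * δ))
    (mul_nonneg hn0.le (by linarith))
  obtain ⟨hL1, hL2⟩ := natCeil_exp_bounds (x := n * IV) (mul_nonneg hn0.le hIV0)
  set M := ⌈Real.exp (n * (IW - IV - 2 * δ))⌉₊ with hM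
  set L := ⌈Real.exp (n * IV)⌉₊ with hL
  have hM0 : (0 : ℝ) < M := (Real.exp_pos _).trans_le hM1
  have hL0 : (0 : ℝ) < L := (Real.exp_pos _).trans_le hL1
  have hMpos : 0 < M := by exact_mod_cast hM0
  have hLpos : 0 < L := by exact_mod_cast hL0
  have : Nonempty (Fin M) := ⟨⟨0, hMpos⟩⟩
  have : Nonempty (Fin L) := ⟨⟨0, hLpos⟩⟩
  -- The threshold exponent `IW - δ` lies between the codebook exponent `IW - 2 * δ` and `IW`. The
  -- weight `1 / n` measures leakage per letter.
  obtain ⟨c, dec, hc, hbound⟩ := exists_codebook (μ := Fin M) (ℓ := Fin L)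
    (iid_isPMF (ι := Fin n) hp) (memoryless_isPMF hW) (memoryless_isPMF hV)
    (T := Real.exp (n * (IW - δ))) (s := 1 / (n : ℝ)) (Real.exp_pos _) (by positivity)
  have hthr := sum_threshold_le hp hW hn1 hδ0
  have hcov := sum_log_one_add_le hp hV hn1 (half_pos hη) hL1
  simp only [Fintype.card_prod, Fintype.card_fin, Nat.cast_mul] at hbound
  have hML : (M : ℝ) * L / Real.exp (n * (IW - δ)) ≤ 4 / δ / n := by
    have h1 : (M : ℝ) * L ≤ 4 * Real.exp (n * (IW - 2 * δ)) := by
      have : n * (IW - 2 * δ) = n * (IW - IV - 2 * δ) + n * IV := by ring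
      rw [this, Real.exp_add]
      have := mul_le_mul hM2 hL2 hL0.le (by positivity)
      linarith
    have h2 : Real.exp (n * (IW - δ)) = Real.exp (n * (IW - 2 * δ)) * Real.exp (n * δ) := by
      rw [← Real.exp_add]; ring_nf
    have h3 : n * δ ≤ Real.exp (n * δ) := by have := Real.add_one_le_exp (n * δ); linarith
    rw [div_div, div_le_div_iff₀ (Real.exp_pos _) (by positivity)]
    calc (M : ℝ) * L * (δ * n) ≤ 4 * Real.exp (n * (IW - 2 * δ)) * Real.exp (n * δ) := by
          refine mul_le_mul h1 (by linarith) (by positivity) (by positivity)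
      _ = _ := by rw [h2]; ring
  -- Since both error and leakage are nonnegative, the bound on their sum bounds each.
  have hE0 : 0 ≤ 1 / ((M : ℝ) * L) *
      (∑ k, ∑ y, memoryless W (c k) y * if dec y ≠ k.1 then 1 else 0) := by
    refine mul_nonneg (by positivity) (sum_nonneg fun k _ => sum_nonneg fun y _ => mul_nonneg
      ((memoryless_isPMF hW _).nonneg y) (by split_ifs <;> norm_num))
  have hS0 : 0 ≤ 1 / (M : ℝ) * ∑ w, relEntropy (binLaw (memoryless V) c w)
      (outputLaw (iid p) (memoryless V)) := by
    refine mul_nonneg (by positivity) (sum_nonneg fun w _ => ?_)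
    exact relEntropy_nonneg (binLaw_isPMF (memoryless_isPMF hV) c w)
      (outputLaw_isPMF (iid_isPMF hp) (memoryless_isPMF hV))
      fun z hz => binLaw_eq_zero (iid_isPMF hp) (memoryless_isPMF hV) hc w hz
  have htotal : (1 / ((M : ℝ) * L) *
      (∑ k, ∑ y, memoryless W (c k) y * if dec y ≠ k.1 then 1 else 0)) +
      1 / (n : ℝ) * (1 / (M : ℝ) * ∑ w, relEntropy (binLaw (memoryless V) c w)
      (outputLaw (iid p) (memoryless V))) ≤ η := by
    refine hbound.trans ?_
    have h1 := mul_le_mul_of_nonneg_left hcov (by positivity : (0 : ℝ) ≤ 1 / n)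
    have h2 : 1 / (n : ℝ) * (Real.log 2 + n * (η / 2) + infoVariance p V / (4 * (η / 2))) +
        infoVariance p W / δ ^ 2 / n + 4 / δ / n = C / n + η / 2 := by
      rw [hC]; field_simp; ring
    linarith
  refine ⟨c, dec, hMpos, hLpos, hc, ?_, ?_, ?_⟩
  · have h1 := Real.log_le_log (Real.exp_pos _) hM1
    have h2 := Real.log_le_log hM0 hM2
    rw [Real.log_exp] at h1
    rw [Real.log_mul (by norm_num) (Real.exp_pos _).ne', Real.log_exp] at h2
    have h3 : Real.log 2 / n ≤ η / 2 := (div_le_div_of_nonneg_right hC2 hn0.le).trans hCn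
    rw [div_le_iff₀ hn0] at h3
    have h4 : Real.log M / n - (IW - IV) = (Real.log M - n * (IW - IV)) / n := by
      field_simp
    have h5 : n * (4 * δ) ≤ n * η := mul_le_mul_of_nonneg_left hδη hn0.le
    have h6 : 0 < n * δ := by positivity
    rw [h4, abs_le, le_div_iff₀ hn0, div_le_iff₀ hn0]
    constructor <;> nlinarith
  · have : 0 ≤ 1 / (n : ℝ) * (1 / (M : ℝ) * ∑ w, relEntropy (binLaw (memoryless V) c w)
      (outputLaw (iid p) (memoryless V))) := mul_nonneg (by positivity) hS0
    linarith
  · have h1 : 1 / (n : ℝ) * (1 / (M : ℝ) * ∑ w, relEntropy (binLaw (memoryless V) c w)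
      (outputLaw (iid p) (memoryless V))) ≤ η := by linarith
    rwa [one_div_mul_eq_div, div_le_iff₀ hn0, mul_comm η] at h1

end Memoryless

/-! ### The two letter channels of the scheme and their mutual informations. -/

section BinaryChannels

lemma sum_zmod_two (f : ZMod 2 → ℝ) : ∑ a, f a = f 0 + f 1 := Fin.sum_univ_two f

lemma zmod_two_cases (a : ZMod 2) : a = 0 ∨ a = 1 := by
  revert a; decide

lemma bern_zero (p : ℝ) : bern p 0 = 1 - p := by simp [bern]

lemma bern_one (p : ℝ) : bern p 1 = p := by simp [bern]

lemma bern_isPMF {p : ℝ} (hp : p ∈ Set.Icc (0 : ℝ) 1) : IsPMF (bern p) := by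
  refine ⟨fun a => ?_, by rw [sum_zmod_two, bern_zero, bern_one]; ring⟩
  unfold bern
  split_ifs <;> linarith [hp.1, hp.2]

/-- The letter law from the source to the half-duplex destination. -/
def destinationChannel (ε t : ℝ) (a : ZMod 2) (b : Option (ZMod 2)) : ℝ :=
  ∑ x₁, ∑ n₁, if (if x₁ = 1 then none else some (a + n₁)) = b then bern t x₁ * bern ε n₁ else 0

/-- The letter law from the source to the wiretapper. -/
def wiretapChannel (δ t : ℝ) (a z : ZMod 2) : ℝ :=
  ∑ x₁, ∑ n₂, if a + x₁ + n₂ = z then bern t x₁ * bern δ n₂ else 0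

lemma destinationChannel_none (ε t : ℝ) (a : ZMod 2) : destinationChannel ε t a none = t := by
  simp [destinationChannel, sum_zmod_two, bern]
  ring

lemma destinationChannel_some (ε t : ℝ) (a b : ZMod 2) :
    destinationChannel ε t a (some b) = (1 - t) * bern ε (a + b) := by
  have h : (1 : ZMod 2) + 1 = 0 := by decide
  rcases zmod_two_cases a with rfl | rfl <;> rcases zmod_two_cases b with rfl | rfl <;>
    simp [destinationChannel, sum_zmod_two, bern, h]

lemma wiretapChannel_apply (δ t : ℝ) (a z : ZMod 2) :
    wiretapChannel δ t a z = bern (star δ t) (a + z) := by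
  have h : (1 : ZMod 2) + 1 = 0 := by decide
  rcases zmod_two_cases a with rfl | rfl <;> rcases zmod_two_cases z with rfl | rfl <;>
    simp [wiretapChannel, sum_zmod_two, bern, h, star] <;> ring

lemma star_mem {a b : ℝ} (ha : a ∈ Set.Icc (0 : ℝ) 1) (hb : b ∈ Set.Icc (0 : ℝ) 1) :
    star a b ∈ Set.Icc (0 : ℝ) 1 := by
  obtain ⟨ha0, ha1⟩ := ha
  obtain ⟨hb0, hb1⟩ := hb
  unfold star
  constructor <;> nlinarith [mul_nonneg ha0 hb0, mul_nonneg ha0 (sub_nonneg.2 hb1),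
    mul_nonneg (sub_nonneg.2 ha1) hb0, mul_nonneg (sub_nonneg.2 ha1) (sub_nonneg.2 hb1)]

lemma sum_bern_add {p : ℝ} (f : ℝ → ℝ) (a : ZMod 2) :
    ∑ b, f (bern p (a + b)) = f (1 - p) + f p := by
  have h : (1 : ZMod 2) + 1 = 0 := by decide
  rcases zmod_two_cases a with rfl | rfl
  · simp [sum_zmod_two, bern_zero, bern_one]
  · simp [sum_zmod_two, bern_zero, bern_one, h, add_comm]

lemma destinationChannel_isPMF {ε t : ℝ} (hε : ε ∈ Set.Icc (0 : ℝ) 1)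
    (ht : t ∈ Set.Icc (0 : ℝ) 1) (a : ZMod 2) : IsPMF (destinationChannel ε t a) := by
  refine ⟨fun b => ?_, ?_⟩
  · cases b with
    | none => rw [destinationChannel_none]; exact ht.1
    | some b =>
      rw [destinationChannel_some]
      exact mul_nonneg (by linarith [ht.2]) ((bern_isPMF hε).nonneg _)
  · rw [Fintype.sum_option]
    simp only [destinationChannel_none, destinationChannel_some]
    rw [sum_bern_add (fun x => (1 - t) * x)]
    ring

lemma wiretapChannel_isPMF {δ t : ℝ} (hδ : δ ∈ Set.Icc (0 : ℝ) 1)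
    (ht : t ∈ Set.Icc (0 : ℝ) 1) (a : ZMod 2) : IsPMF (wiretapChannel δ t a) := by
  refine ⟨fun z => ?_, ?_⟩
  · rw [wiretapChannel_apply]
    exact (bern_isPMF (star_mem hδ ht)).nonneg _
  · simp only [wiretapChannel_apply]
    rw [sum_bern_add (fun x => x)]
    ring

lemma mutualInfo_eq {α β : Type*} [Fintype α] [Fintype β] {p : α → ℝ} {W : α → β → ℝ}
    (hp : IsPMF p) (hW : ∀ a, IsPMF (W a)) :
    mutualInfo p W = ∑ b, Real.negMulLog (outputLaw p W b) -
      ∑ a, p a * ∑ b, Real.negMulLog (W a b) := by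
  have h : ∀ a b, p a * W a b * Real.log (W a b / outputLaw p W b) =
      p a * W a b * -Real.log (outputLaw p W b) - p a * Real.negMulLog (W a b) := by
    intro a b
    rcases eq_or_ne (p a * W a b) 0 with h0 | h0
    · rcases mul_eq_zero.1 h0 with h | h <;> simp [h]
    · have hpos : 0 < p a * W a b :=
        (mul_nonneg (hp.nonneg a) ((hW a).nonneg b)).lt_of_ne' h0
      rw [Real.log_div (right_ne_zero_of_mul h0)
        (hpos.trans_le (mul_le_outputLaw hp hW a b)).ne', Real.negMulLog]
      ring
  simp only [mutualInfo, h, sum_sub_distrib, mul_sum]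
  congr 1
  rw [sum_comm]
  simp only [← sum_mul, Real.negMulLog]
  exact sum_congr rfl fun b _ => by simp only [outputLaw]; ring

lemma outputLaw_destinationChannel_none (μ ε t : ℝ) :
    outputLaw (bern μ) (destinationChannel ε t) none = t := by
  simp only [outputLaw, destinationChannel_none, sum_zmod_two, bern_zero, bern_one]
  ring

lemma sum_bern_mul_bern_add (μ p : ℝ) (b : ZMod 2) :
    ∑ a, bern μ a * bern p (a + b) = bern (star p μ) b := by
  have h : (1 : ZMod 2) + 1 = 0 := by decide
  rcases zmod_two_cases b with rfl | rfl <;>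
    simp [sum_zmod_two, bern_zero, bern_one, h, star] <;> ring

lemma outputLaw_destinationChannel_some (μ ε t : ℝ) (b : ZMod 2) :
    outputLaw (bern μ) (destinationChannel ε t) (some b) = (1 - t) * bern (star ε μ) b := by
  rw [← sum_bern_mul_bern_add, mul_sum]
  simp only [outputLaw, destinationChannel_some]
  exact sum_congr rfl fun a _ => by ring

lemma outputLaw_wiretapChannel (μ δ t : ℝ) (z : ZMod 2) :
    outputLaw (bern μ) (wiretapChannel δ t) z = bern (star (star δ t) μ) z := by
  rw [← sum_bern_mul_bern_add]
  simp only [outputLaw, wiretapChannel_apply]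

lemma sum_negMulLog_bern_add (p : ℝ) (a : ZMod 2) :
    ∑ b, Real.negMulLog (bern p (a + b)) = Real.binEntropy p := by
  rw [sum_bern_add, Real.binEntropy_eq_negMulLog_add_negMulLog_one_sub, add_comm]

lemma sum_negMulLog_mul_bern_add (s p : ℝ) (a : ZMod 2) :
    ∑ b, Real.negMulLog (s * bern p (a + b)) = Real.negMulLog s + s * Real.binEntropy p := by
  simp only [Real.negMulLog_mul]
  rw [sum_add_distrib, ← sum_mul, ← mul_sum, sum_negMulLog_bern_add, sum_bern_add (fun x => x)]
  ring

/-- Erasures occur with probability `t` whatever the input, so their entropy cancels between the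
output entropy and the conditional entropy; the rest is scaled by `1 - t`. -/
lemma mutualInfo_destinationChannel {μ ε t : ℝ} (hμ : μ ∈ Set.Icc (0 : ℝ) 1)
    (hε : ε ∈ Set.Icc (0 : ℝ) 1) (ht : t ∈ Set.Icc (0 : ℝ) 1) :
    mutualInfo (bern μ) (destinationChannel ε t) =
      (1 - t) * (Real.binEntropy (star ε μ) - Real.binEntropy ε) := by
  rw [mutualInfo_eq (bern_isPMF hμ) (destinationChannel_isPMF hε ht)]
  simp only [Fintype.sum_option, outputLaw_destinationChannel_none,
    outputLaw_destinationChannel_some, destinationChannel_none, destinationChannel_some,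
    sum_negMulLog_mul_bern_add, ← sum_mul, (bern_isPMF hμ).sum_eq_one]
  have := sum_negMulLog_mul_bern_add (1 - t) (star ε μ) 0
  simp only [zero_add] at this
  rw [this]
  ring

lemma mutualInfo_wiretapChannel {μ δ t : ℝ} (hμ : μ ∈ Set.Icc (0 : ℝ) 1)
    (hδ : δ ∈ Set.Icc (0 : ℝ) 1) (ht : t ∈ Set.Icc (0 : ℝ) 1) :
    mutualInfo (bern μ) (wiretapChannel δ t) =
      Real.binEntropy (star (star δ t) μ) - Real.binEntropy (star δ t) := by
  rw [mutualInfo_eq (bern_isPMF hμ) (wiretapChannel_isPMF hδ ht)]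
  simp only [outputLaw_wiretapChannel, wiretapChannel_apply, sum_negMulLog_bern_add, ← sum_mul,
    (bern_isPMF hμ).sum_eq_one, one_mul]
  have := sum_negMulLog_bern_add (star (star δ t) μ) 0
  simp only [zero_add] at this
  rw [this]

lemma prod_sum_sum {ι α β : Type*} [Fintype ι] [DecidableEq ι] [Fintype α] [Fintype β]
    (F : ι → α → β → ℝ) :
    ∏ i, ∑ a, ∑ b, F i a b = ∑ u : ι → α, ∑ v : ι → β, ∏ i, F i (u i) (v i) := by
  rw [← sum_prod_apply (fun i a => ∑ b, F i a b)]
  exact sum_congr rfl fun u _ => (sum_prod_apply fun i b => F i (u i) b).symm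

lemma memoryless_destinationChannel (ε t : ℝ) {n : ℕ} (x : Word n) (y : Fin n → Option (ZMod 2)) :
    memoryless (destinationChannel ε t) x y =
      ∑ x₁, ∑ n₁, if received x x₁ n₁ = y then iidBern t x₁ * iidBern ε n₁ else 0 := by
  simp only [memoryless, destinationChannel]
  rw [prod_sum_sum]
  refine sum_congr rfl fun x₁ _ => sum_congr rfl fun n₁ _ => ?_
  rw [prod_ite_zero, prod_mul_distrib]
  simp [funext_iff, received, iidBern]

lemma memoryless_wiretapChannel (δ t : ℝ) {n : ℕ} (x z : Word n) :
    memoryless (wiretapChannel δ t) x z =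
      ∑ x₁, ∑ n₂, if overheard x x₁ n₂ = z then iidBern t x₁ * iidBern δ n₂ else 0 := by
  simp only [memoryless, wiretapChannel]
  rw [prod_sum_sum]
  refine sum_congr rfl fun x₁ _ => sum_congr rfl fun n₂ _ => ?_
  rw [prod_ite_zero, prod_mul_distrib]
  simp [funext_iff, overheard, iidBern]

end BinaryChannels

/-! ### From codebooks to codes for the scheme. -/

section Codes

variable {ε δ : ℝ} {M n : ℕ}

/-- The wiretapper's noise sums out through `fst_marginal`, so correlation between the noises is
irrelevant. -/
lemma errorProb_eq (N : BSCNoise ε δ) (t : ℝ) (c : Code M n) :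
    errorProb N t c = 1 / (M : ℝ) * ∑ w, ∑ x, c.enc w x *
      ∑ y, memoryless (destinationChannel ε t) x y * if c.dec y ≠ w then 1 else 0 := by
  simp only [errorProb, memoryless_destinationChannel]
  rw [mul_sum]
  refine sum_congr rfl fun w _ => ?_
  rw [mul_sum]
  refine sum_congr rfl fun x _ => ?_
  have h : ∀ y : Fin n → Option (ZMod 2),
      (∑ x₁, ∑ n₁, if received x x₁ n₁ = y then iidBern t x₁ * iidBern ε n₁ else 0) *
        (if c.dec y ≠ w then 1 else 0) =
      ∑ x₁, ∑ n₁, if received x x₁ n₁ = y then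
        iidBern t x₁ * iidBern ε n₁ * (if c.dec y ≠ w then 1 else 0) else 0 := by
    intro y
    simp only [sum_mul, ite_mul, zero_mul]
  simp only [h]
  rw [sum_comm (s := univ (α := Fin n → Option (ZMod 2))), mul_sum, mul_sum]
  refine sum_congr rfl fun x₁ _ => ?_
  rw [sum_comm (s := univ (α := Fin n → Option (ZMod 2))), mul_sum, mul_sum]
  refine sum_congr rfl fun n₁ _ => ?_
  rw [sum_ite_eq univ (received x x₁ n₁), if_pos (mem_univ _)]
  by_cases hd : c.dec (received x x₁ n₁) = w
  · simp [hd]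
  · simp only [jointProb, ne_eq, hd, not_false_eq_true, if_true, ← mul_sum, N.fst_marginal]
    ring

lemma messageObsProb_eq (N : BSCNoise ε δ) (t : ℝ) (c : Code M n) (w : Fin M) (z : Word n) :
    messageObsProb N t c w z =
      1 / (M : ℝ) * ∑ x, c.enc w x * memoryless (wiretapChannel δ t) x z := by
  simp only [messageObsProb, memoryless_wiretapChannel]
  rw [mul_sum]
  refine sum_congr rfl fun x _ => ?_
  rw [mul_sum, mul_sum]
  refine sum_congr rfl fun x₁ _ => ?_
  rw [sum_comm, mul_sum, mul_sum]
  refine sum_congr rfl fun n₂ _ => ?_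
  by_cases ho : overheard x x₁ n₂ = z
  · simp only [jointProb, ho, if_true, ← mul_sum, N.snd_marginal]
    ring
  · simp [ho]

/-- The code that sends a uniformly chosen codeword from the bin of the message. -/
def binningCode {L : ℕ} (hL : 0 < L) (c : Fin M × Fin L → Word n)
    (dec : (Fin n → Option (ZMod 2)) → Fin M) : Code M n where
  enc w x := 1 / (L : ℝ) * ∑ l, if c (w, l) = x then 1 else 0
  enc_nonneg w x := mul_nonneg (by positivity) (sum_nonneg fun l _ => by split_ifs <;> norm_num)
  enc_sum w := by
    have : (L : ℝ) ≠ 0 := by exact_mod_cast hL.ne'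
    rw [← mul_sum, sum_comm]
    simp [this]
  dec := dec

lemma sum_binningCode_enc_mul {L : ℕ} (hL : 0 < L) (c : Fin M × Fin L → Word n)
    (dec : (Fin n → Option (ZMod 2)) → Fin M) (w : Fin M) (g : Word n → ℝ) :
    ∑ x, (binningCode hL c dec).enc w x * g x = 1 / (L : ℝ) * ∑ l, g (c (w, l)) := by
  simp only [binningCode, mul_assoc, ← mul_sum, sum_mul, ite_mul, one_mul, zero_mul]
  rw [sum_comm]
  simp

lemma errorProb_binningCode (N : BSCNoise ε δ) (t : ℝ) {L : ℕ} (hL : 0 < L)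
    (c : Fin M × Fin L → Word n) (dec : (Fin n → Option (ZMod 2)) → Fin M) :
    errorProb N t (binningCode hL c dec) = 1 / ((M : ℝ) * L) * ∑ k, ∑ y,
      memoryless (destinationChannel ε t) (c k) y * if dec y ≠ k.1 then 1 else 0 := by
  rw [errorProb_eq]
  simp only [sum_binningCode_enc_mul]
  rw [Fintype.sum_prod_type, ← mul_sum, ← mul_assoc, one_div_mul_one_div]
  rfl

lemma messageObsProb_binningCode (N : BSCNoise ε δ) (t : ℝ) {L : ℕ} (hL : 0 < L)
    (c : Fin M × Fin L → Word n) (dec : (Fin n → Option (ZMod 2)) → Fin M) :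
    messageObsProb N t (binningCode hL c dec) = fun w z =>
      1 / (M : ℝ) * binLaw (memoryless (wiretapChannel δ t)) c w z := by
  funext w z
  rw [messageObsProb_eq, sum_binningCode_enc_mul hL c dec w
    (fun x => memoryless (wiretapChannel δ t) x z)]
  simp [binLaw]

/-- The code with a single message. -/
def trivialCode (n : ℕ) : Code 1 n where
  enc _ x := if x = 0 then 1 else 0
  enc_nonneg _ x := by split_ifs <;> norm_num
  enc_sum _ := by simp
  dec _ := 0

lemma schemeAchieves_zero (N : BSCNoise ε δ) (t : ℝ) : SchemeAchieves N t 0 := by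
  intro η hη
  refine ⟨0, fun n _ => ⟨1, trivialCode n, ?_, ?_, ?_⟩⟩
  · simpa using hη.le
  · have : errorProb N t (trivialCode n) = 0 := by
      have hdec : ∀ y, (trivialCode n).dec y = 0 := fun _ => rfl
      simp [errorProb, hdec]
    rw [this]; exact hη.le
  · have : condEntropy (messageObsProb N t (trivialCode n)) = 0 := by
      simp only [condEntropy, univ_unique, sum_singleton, neg_eq_zero]
      refine sum_eq_zero fun z _ => ?_
      rcases eq_or_ne (messageObsProb N t (trivialCode n) default z) 0 with h | h
      · rw [h, zero_mul]
      · rw [div_self h, Real.logb_one, mul_zero]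
    rw [this]
    simpa using hη.le

lemma schemeAchieves_of_pos (N : BSCNoise ε δ) (hε : ε ∈ Set.Icc (0 : ℝ) 1)
    (hδ : δ ∈ Set.Icc (0 : ℝ) 1) {μ t R : ℝ} (hμ : μ ∈ Set.Icc (0 : ℝ) 1)
    (ht : t ∈ Set.Icc (0 : ℝ) 1) (hR : R = (1 - t) * (H (star ε μ) - H ε) -
      (H (star (star δ t) μ) - H (star δ t))) (hpos : 0 < R) : SchemeAchieves N t R := by
  intro η hη
  have hlog : 0 < Real.log 2 := Real.log_pos (by norm_num)
  have hlog1 : Real.log 2 < 1 := by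
    have := Real.log_lt_sub_one_of_pos (x := 2) (by norm_num) (by norm_num); linarith
  have hp := bern_isPMF hμ
  have hW := destinationChannel_isPMF hε ht
  have hV := wiretapChannel_isPMF hδ ht
  have hrate : mutualInfo (bern μ) (destinationChannel ε t) -
      mutualInfo (bern μ) (wiretapChannel δ t) = R * Real.log 2 := by
    rw [mutualInfo_destinationChannel hμ hε ht, mutualInfo_wiretapChannel hμ hδ ht, hR]
    simp only [H]
    field_simp
  have hlt : mutualInfo (bern μ) (wiretapChannel δ t) <
      mutualInfo (bern μ) (destinationChannel ε t) := by
    have : 0 < R * Real.log 2 := by positivity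
    linarith
  -- The factor `Real.log 2` converts bits to nats; the half is there because the equivocation loses
  -- both the rate deviation and the leakage.
  obtain ⟨n₀, hn₀⟩ := exists_memoryless_codebook hp hW hV hlt
    (η := η * Real.log 2 / 2) (by positivity)
  refine ⟨n₀, fun n hn => ?_⟩
  obtain ⟨hn1, M, L, c, dec, hM, hL, hc, hMrate, herr, hleak⟩ := hn₀ n hn
  have hn0 : (0 : ℝ) < n := by exact_mod_cast hn1
  have : Nonempty (Fin L) := ⟨⟨0, hL⟩⟩
  rw [hrate, abs_le] at hMrate
  obtain ⟨hlow, hup⟩ := hMrate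
  have hlogb : Real.logb 2 M / n = Real.log M / n / Real.log 2 := by
    rw [Real.logb, div_right_comm]
  have hlow' : R - η / 2 ≤ Real.logb 2 M / n := by
    rw [hlogb, le_div_iff₀ hlog]; linarith
  have hup' : Real.logb 2 M / n ≤ R + η / 2 := by
    rw [hlogb, div_le_iff₀ hlog]; linarith
  refine ⟨M, binningCode hL c dec, ?_, ?_, ?_⟩
  · rw [abs_le]; constructor <;> linarith
  · rw [errorProb_binningCode]
    refine herr.trans ?_
    nlinarith
  · rw [messageObsProb_binningCode]
    have h := logb_sub_le_condEntropy hM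
      (fun w => binLaw_isPMF (memoryless_isPMF hV) c w)
      (outputLaw_isPMF (iid_isPMF hp) (memoryless_isPMF hV))
      (fun w z hz => binLaw_eq_zero (iid_isPMF hp) (memoryless_isPMF hV) hc w hz)
    refine le_trans ?_ (div_le_div_of_nonneg_right h hn0.le)
    have h2 : 1 / (M : ℝ) * (∑ w, relEntropy (binLaw (memoryless (wiretapChannel δ t)) c w)
        (outputLaw (iid (bern μ)) (memoryless (wiretapChannel δ t)))) / Real.log 2 / n ≤ η / 2 := by
      rw [div_le_iff₀ hn0, div_le_iff₀ hlog]
      linarith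
    rw [sub_div]
    linarith

end Codes

lemma continuous_secrecyRate (ε δ : ℝ) :
    Continuous fun s : ℝ × ℝ => secrecyRate ε δ s.1 s.2 := by
  have hH : Continuous H := Real.binEntropy_continuous.div_const _
  unfold secrecyRate star
  fun_prop

end HalfDuplexWiretap

end

theorem theorem3 (ε δ : ℝ) (hε : ε ∈ Set.Icc (0 : ℝ) 1) (hδ : δ ∈ Set.Icc (0 : ℝ) 1)
    (N : HalfDuplexWiretap.BSCNoise ε δ) :
    ∃ μ ∈ Set.Icc (0 : ℝ) 1, ∃ t ∈ Set.Icc (0 : ℝ) 1,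
      (∀ μ' ∈ Set.Icc (0 : ℝ) 1, ∀ t' ∈ Set.Icc (0 : ℝ) 1,
        HalfDuplexWiretap.secrecyRate ε δ μ' t' ≤ HalfDuplexWiretap.secrecyRate ε δ μ t) ∧
      HalfDuplexWiretap.SchemeAchieves N t (HalfDuplexWiretap.secrecyRate ε δ μ t) := by
  obtain ⟨⟨μ, t⟩, ⟨hμ, ht⟩, hmax⟩ := (isCompact_Icc.prod isCompact_Icc).exists_isMaxOn
    (s := Set.Icc (0 : ℝ) 1 ×ˢ Set.Icc (0 : ℝ) 1) ⟨(0, 0), by simp⟩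
    (HalfDuplexWiretap.continuous_secrecyRate ε δ).continuousOn
  refine ⟨μ, hμ, t, ht, fun μ' hμ' t' ht' => hmax (Set.mk_mem_prod hμ' ht'), ?_⟩
  have h0 : 0 ≤ HalfDuplexWiretap.secrecyRate ε δ μ t := le_max_left 0 _
  -- Binning needs a strictly positive rate, so a zero maximum is treated separately.
  rcases h0.eq_or_lt with h | h
  · rw [← h]
    exact HalfDuplexWiretap.schemeAchieves_zero N t
  · refine HalfDuplexWiretap.schemeAchieves_of_pos N hε hδ hμ ht ?_ h
    refine max_eq_right ?_
    rcases lt_max_iff.1 h with h' | h'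
    · exact absurd h' (lt_irrefl _)
    · exact h'.le
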